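/- Let $B$ be a unital complex Banach algebra and let $A$ be a unital C*-algebra that admits a faithful tracial state, that is, a positive linear functional $\tau\colon A\to\mathbb{C}$ such that $\tau(1)=1$, $\tau(ab)=\tau(ba)$ for all $a,b\in A$, and $\tau(a^*a)=0$ implies $a=0$. Let $G(A)$ denote the group of invertible elements of $A$, and let $G_1(B)$ denote the principal component of the group $G(B)$ of invertible elements of $B$, that is, the connected component of $G(B)$ containing the identity. Let $T\colon B\to A$ be a surjective linear mapping with $T(1)=1$ (no continuity is assumed) such that $T(G_1(B))\subseteq G(A)$. Then $T$ is a Jordan homomorphism, that is, $T(a^2)=(Ta)^2$ for all $a\in B$. -/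

import Mathlib

section

open scoped ComplexOrder

/-- A faithful tracial state on a unital C*-algebra: a linear functional which is a state
(positive and unital, equivalently positive of norm `1`), has the trace property,
and is faithful. -/
structure IsFaithfulTracialState {A : Type*} [CStarAlgebra A] (τ : A →ₗ[ℂ] ℂ) : Prop where
  map_one : τ 1 = 1
  nonneg : ∀ a : A, 0 ≤ τ (star a * a)
  trace : ∀ a b : A, τ (a * b) = τ (b * a)
  faithful : ∀ a : A, τ (star a * a) = 0 → a = 0

end

/-- The principal component `G₁(B)` of the group of invertible elements of `B`: the elements of
the connected component of the identity in the topological group `Bˣ`, viewed in `B`. -/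
def principalComponent (B : Type*) [NormedRing B] : Set B :=
  (fun u : Bˣ => (u : B)) '' connectedComponent (1 : Bˣ)

/-- A linear mapping between complex algebras is a Jordan homomorphism if it preserves squares. -/
def IsJordanHom {B A : Type*} [Ring B] [Algebra ℂ B] [Ring A] [Algebra ℂ A]
    (T : B →ₗ[ℂ] A) : Prop :=
  ∀ a : B, T (a ^ 2) = T a ^ 2

open Set Filter Topology MeasureTheory

/-! By faithfulness and surjectivity it is enough to show `φ (T (a ^ 2) * T b) = φ (T a ^ 2 * T b)`
under the trace `φ` (`trace_map_sq_mul`). By polarization this follows from a quadratic and a cubic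
trace identity. The tool is a logarithm of the Fuglede–Kadison determinant. Since `φ` is tracial,
the integral of `φ (F⁻¹ F')` along a path of units from 1 can be compared with its endpoint, and its
real part is at most the logarithm of any strict bound for the spectrum there (`re_le_log`). For a
holomorphic curve of units, Borel–Carathéodory and Cauchy then bound the second and third
derivatives at 0 (`norm_jet_le`). Apply this to the image under `T` of `(1 + z a / n) ^ n (1 + z b /
n) ^ n`, a polynomial stand-in for `exp (z a) exp (z b)` that needs no continuity of `T`. On a disc
of radius comparable to `n` the curve stays in the principal component, and `T` keeps spectra within
the norm, so the log bound is `O(n)`. The derivative bounds are `O(n / n ^ 2)` and `O(n / n ^ 3)`,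
and `n → ∞` gives the identities. -/

namespace TracialState

/-! ### Integrals of the traced logarithmic derivative along paths of units. -/

section


variable {A : Type*} [CStarAlgebra A]

/-- The derivative of the inverse along a curve of units in a Banach algebra. -/
lemma hasDerivAt_ringInverse {𝕜 R : Type*} [NontriviallyNormedField 𝕜] [NormedRing R]
    [NormedAlgebra 𝕜 R] [CompleteSpace R] {F : 𝕜 → R} {F' : R} {t : 𝕜}
    (hF : HasDerivAt F F' t) (hu : IsUnit (F t)) :
    HasDerivAt (fun s => Ring.inverse (F s))
      (-(Ring.inverse (F t) * F' * Ring.inverse (F t))) t := by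
  obtain ⟨u, hu⟩ := hu
  have h := hasFDerivAt_ringInverse (𝕜 := 𝕜) u
  rw [hu] at h
  have h2 := h.comp_hasDerivAt t hF
  simpa [← hu, Function.comp_def] using h2

lemma continuousOn_ringInverse {X R : Type*} [TopologicalSpace X] [NormedRing R]
    [CompleteSpace R] {F : X → R} {s : Set X}
    (hF : ContinuousOn F s) (hu : ∀ x ∈ s, IsUnit (F x)) :
    ContinuousOn (fun x => Ring.inverse (F x)) s := by
  intro x hx
  obtain ⟨u, hu⟩ := hu x hx
  have h := NormedRing.inverse_continuousAt u
  rw [hu] at h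
  exact h.comp_continuousWithinAt (hF x hx)

/-- A positive functional on a unital C*-algebra is continuous. -/
lemma exists_continuousLinearMap {τ : A →ₗ[ℂ] ℂ} (hτ : IsFaithfulTracialState τ) :
    ∃ φ : A →L[ℂ] ℂ, (φ : A →ₗ[ℂ] ℂ) = τ := by
  let _ := CStarAlgebra.spectralOrder A
  have _ := CStarAlgebra.spectralOrderedRing A
  open scoped ComplexOrder in
  let p : A →ₚ[ℂ] ℂ := PositiveLinearMap.mk₀ τ (by
    intro a ha
    obtain ⟨b, rfl⟩ := CStarAlgebra.nonneg_iff_eq_star_mul_self.mp ha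
    exact hτ.nonneg b)
  obtain ⟨C, hC⟩ := p.exists_norm_apply_le
  exact ⟨τ.mkContinuous C hC, rfl⟩

variable {φ : A →L[ℂ] ℂ}

lemma trace_mul_comm (hφ : IsFaithfulTracialState (φ : A →ₗ[ℂ] ℂ)) (a b : A) :
    φ (a * b) = φ (b * a) := hφ.trace a b

open scoped ComplexOrder in
lemma re_nonneg [PartialOrder A] [StarOrderedRing A]
    (hφ : IsFaithfulTracialState (φ : A →ₗ[ℂ] ℂ)) {a : A} (ha : 0 ≤ a) : 0 ≤ (φ a).re := by
  obtain ⟨b, rfl⟩ := CStarAlgebra.nonneg_iff_eq_star_mul_self.mp ha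
  exact (Complex.le_def.mp (hφ.nonneg b)).1

open scoped ComplexOrder in
-- Positivity makes `φ (star b * b)` real; `b = 1 + a` yields the imaginary part and `b = 1 + I • a`
-- the real part.
lemma map_star (hφ : IsFaithfulTracialState (φ : A →ₗ[ℂ] ℂ)) (a : A) :
    φ (star a) = star (φ a) := by
  have him : ∀ b : A, (φ (star b * b)).im = 0 := fun b => ((Complex.le_def.mp (hφ.nonneg b)).2).symm
  have h1 := him (1 + a)
  have h2 := him (1 + Complex.I • a)
  have h3 := him a
  have h4 : (φ 1).im = 0 := by simpa using him 1
  simp only [star_add, star_one, star_smul, add_mul, mul_add, one_mul, mul_one, map_add,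
    smul_mul_assoc, mul_smul_comm, map_smul, Complex.add_im, smul_eq_mul, Complex.mul_im,
    Complex.mul_re, RCLike.star_def, Complex.conj_I, Complex.neg_im, Complex.neg_re,
    Complex.I_re, Complex.I_im, h3, h4] at h1 h2
  apply Complex.ext
  · simp; linarith
  · simp; linarith

/-- A `C¹` path of units starting at `1`. -/
structure IsUnitPath {R : Type*} [NormedRing R] [NormedAlgebra ℝ R] (F F' : ℝ → R) : Prop where
  hasDerivAt : ∀ t ∈ Icc (0 : ℝ) 1, HasDerivAt F (F' t) t
  continuousOn_deriv : ContinuousOn F' (Icc 0 1)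
  isUnit : ∀ t ∈ Icc (0 : ℝ) 1, IsUnit (F t)
  map_zero : F 0 = 1

lemma IsUnitPath.continuousOn {R : Type*} [NormedRing R] [NormedAlgebra ℝ R] {F F' : ℝ → R}
    (h : IsUnitPath F F') : ContinuousOn F (Icc 0 1) :=
  fun t ht => (h.hasDerivAt t ht).continuousAt.continuousWithinAt

/-- Keeps the linear homotopy of `integral_logDeriv_eq` inside the units when the path is positive.
-/
lemma isStrictlyPositive_convex [PartialOrder A] [StarOrderedRing A] {x : A}
    (hx : IsStrictlyPositive x) {u : ℝ} (hu : u ∈ Icc (0 : ℝ) 1) :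
    IsStrictlyPositive (1 + u • (x - 1)) := by
  have e : (1 : A) + u • (x - 1) = (1 - u) • (1 : A) + u • x := by
    rw [smul_sub, sub_smul, one_smul]; abel
  rw [e]
  rcases eq_or_lt_of_le hu.1 with h | h
  · subst h; simp
  · exact (IsStrictlyPositive.smul h hx).nonneg_add
      (smul_nonneg (sub_nonneg.2 hu.2) zero_le_one)

/-- If `∂β/∂u = ∂α/∂t` on the unit square then the two pairs of boundary integrals agree. -/
lemma integral_sub_eq_of_hasDerivAt {α β f : ℝ → ℝ → ℂ}
    (hβ : ∀ u ∈ Icc (0:ℝ) 1, ∀ t ∈ Icc (0:ℝ) 1, HasDerivAt (fun u => β u t) (f u t) u)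
    (hα : ∀ u ∈ Icc (0:ℝ) 1, ∀ t ∈ Icc (0:ℝ) 1, HasDerivAt (fun t => α u t) (f u t) t)
    (hf : ContinuousOn (Function.uncurry f) (Icc (0:ℝ) 1 ×ˢ Icc (0:ℝ) 1)) :
    ∫ t in (0:ℝ)..1, (β 1 t - β 0 t) = ∫ u in (0:ℝ)..1, (α u 1 - α u 0) := by
  have hIcc : uIcc (0:ℝ) 1 = Icc 0 1 := uIcc_of_le zero_le_one
  have key1 : ∀ t ∈ Icc (0:ℝ) 1, ∫ u in (0:ℝ)..1, f u t = β 1 t - β 0 t := by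
    intro t ht
    have hc : ContinuousOn (fun u => f u t) (uIcc 0 1) := by
      rw [hIcc]
      exact hf.comp (f := fun u : ℝ => (u, t)) (continuousOn_id.prodMk continuousOn_const)
        (fun u hu => ⟨hu, ht⟩)
    exact intervalIntegral.integral_eq_sub_of_hasDerivAt
      (fun u hu => hβ u (hIcc ▸ hu) t ht) hc.intervalIntegrable
  have key2 : ∀ u ∈ Icc (0:ℝ) 1, ∫ t in (0:ℝ)..1, f u t = α u 1 - α u 0 := by
    intro u hu'
    have hc : ContinuousOn (fun t => f u t) (uIcc 0 1) := by
      rw [hIcc]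
      exact hf.comp (f := fun t : ℝ => (u, t)) (continuousOn_const.prodMk continuousOn_id)
        (fun t ht => ⟨hu', ht⟩)
    exact intervalIntegral.integral_eq_sub_of_hasDerivAt
      (fun t ht => hα u hu' t (hIcc ▸ ht)) hc.intervalIntegrable
  calc ∫ t in (0:ℝ)..1, (β 1 t - β 0 t)
      = ∫ t in (0:ℝ)..1, ∫ u in (0:ℝ)..1, f u t :=
        intervalIntegral.integral_congr fun t ht => (key1 t (hIcc ▸ ht)).symm
    _ = ∫ u in (0:ℝ)..1, ∫ t in (0:ℝ)..1, f u t := by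
        refine (intervalIntegral_intervalIntegral_swap ?_).symm
        refine (hf.integrableOn_compact (isCompact_Icc.prod isCompact_Icc)).mono_set ?_
        rw [← hIcc]
        exact prod_mono uIoc_subset_uIcc uIoc_subset_uIcc
    _ = _ := intervalIntegral.integral_congr fun u hu' => key2 u (hIcc ▸ hu')

/-- Fubini for the logarithmic derivative along the linear homotopy `1 + u (P - 1)`. -/
lemma integral_logDeriv_eq (hφ : IsFaithfulTracialState (φ : A →ₗ[ℂ] ℂ)) {P P' : ℝ → A}
    (hP : IsUnitPath P P')
    (hu : ∀ u ∈ Icc (0 : ℝ) 1, ∀ t ∈ Icc (0 : ℝ) 1, IsUnit (1 + u • (P t - 1))) :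
    ∫ t in (0:ℝ)..1, φ (Ring.inverse (P t) * P' t) =
      ∫ u in (0:ℝ)..1, φ (Ring.inverse (1 + u • (P 1 - 1)) * (P 1 - 1)) := by
  have h := integral_sub_eq_of_hasDerivAt
    (β := fun u t => φ (Ring.inverse (1 + u • (P t - 1)) * (u • P' t)))
    (α := fun u t => φ (Ring.inverse (1 + u • (P t - 1)) * (P t - 1)))
    (f := fun u t => φ (-(Ring.inverse (1 + u • (P t - 1)) * (P t - 1) *
      Ring.inverse (1 + u • (P t - 1))) * (u • P' t) + Ring.inverse (1 + u • (P t - 1)) * P' t))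
    ?_ ?_ ?_
  · simpa [hP.map_zero] using h
  · intro u hu' t ht
    have h1 : HasDerivAt (fun u : ℝ => 1 + u • (P t - 1)) (P t - 1) u := by
      simpa using ((hasDerivAt_id u).smul_const (P t - 1)).const_add 1
    have h2 := hasDerivAt_ringInverse h1 (hu u hu' t ht)
    have h3 : HasDerivAt (fun u : ℝ => u • P' t) (P' t) u := by
      simpa using (hasDerivAt_id u).smul_const (P' t)
    exact (φ.restrictScalars ℝ).hasFDerivAt.comp_hasDerivAt u (h2.mul h3)
  · intro u hu' t ht
    have h0 := (hP.hasDerivAt t ht).sub_const 1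
    have h1 : HasDerivAt (fun t => 1 + u • (P t - 1)) (u • P' t) t :=
      (h0.const_smul u).const_add 1
    have h2 := hasDerivAt_ringInverse h1 (hu u hu' t ht)
    have h3 : HasDerivAt (fun t => φ (Ring.inverse (1 + u • (P t - 1)) * (P t - 1))) _ t :=
      (φ.restrictScalars ℝ).hasFDerivAt.comp_hasDerivAt t (h2.mul h0)
    refine h3.congr_deriv ?_
    generalize Ring.inverse (1 + u • (P t - 1)) = J
    generalize P t - 1 = S
    -- The two mixed derivatives differ only in the order of `S` and `u • P' t` around `J`;
    -- cyclicity of the trace identifies them.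
    change φ (-(J * (u • P' t) * J) * S + J * P' t) = _
    rw [map_add, map_add, neg_mul, neg_mul, map_neg, map_neg, mul_assoc (J * S),
      trace_mul_comm hφ (J * S), ← mul_assoc]
  · have hPc : ContinuousOn (fun q : ℝ × ℝ => P q.2) (Icc (0:ℝ) 1 ×ˢ Icc (0:ℝ) 1) :=
      hP.continuousOn.comp continuousOn_snd (fun q hq => hq.2)
    have hSc := hPc.sub (continuousOn_const (c := (1 : A)))
    have hPc' : ContinuousOn (fun q : ℝ × ℝ => P' q.2) (Icc (0:ℝ) 1 ×ˢ Icc (0:ℝ) 1) :=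
      hP.continuousOn_deriv.comp continuousOn_snd (fun q hq => hq.2)
    have hQc : ContinuousOn (fun q : ℝ × ℝ => 1 + q.1 • (P q.2 - 1))
        (Icc (0:ℝ) 1 ×ˢ Icc (0:ℝ) 1) :=
      continuousOn_const.add (continuousOn_fst.smul hSc)
    have hIc := continuousOn_ringInverse hQc (fun q hq => hu q.1 hq.1 q.2 hq.2)
    exact φ.continuous.comp_continuousOn ((((hIc.mul hSc).mul hIc).neg.mul
      (continuousOn_fst.smul hPc')).add (hIc.mul hPc'))

lemma ringInverse_nonneg [PartialOrder A] [StarOrderedRing A] {x : A}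
    (hx : IsStrictlyPositive x) : 0 ≤ Ring.inverse x := by
  have h := hx.isUnit.ringInverse.star_left_conjugate_nonneg_iff.mpr hx.nonneg
  have h2 : star (Ring.inverse x) = Ring.inverse x := by
    rw [← Ring.inverse_star, hx.isSelfAdjoint.star_eq]
  rwa [h2, Ring.inverse_mul_cancel _ hx.isUnit, one_mul] at h

/-- Writing `a = star c * c`, cyclicity replaces `a * b` by the positive element `c * b * star c`.
-/
lemma trace_mul_nonneg [PartialOrder A] [StarOrderedRing A]
    (hφ : IsFaithfulTracialState (φ : A →ₗ[ℂ] ℂ)) {a b : A} (ha : 0 ≤ a) (hb : 0 ≤ b) :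
    0 ≤ (φ (a * b)).re := by
  obtain ⟨c, rfl⟩ := CStarAlgebra.nonneg_iff_eq_star_mul_self.mp ha
  rw [mul_assoc, trace_mul_comm hφ]
  exact re_nonneg hφ (star_right_conjugate_nonneg hb c)

/-- The path may be replaced by the segment from 1 to `P 1`, where the integrand is minus the trace
of a product of two positive elements. -/
lemma re_integral_logDeriv_nonpos_of_le_one [PartialOrder A] [StarOrderedRing A]
    (hφ : IsFaithfulTracialState (φ : A →ₗ[ℂ] ℂ)) {P P' : ℝ → A} (hP : IsUnitPath P P')
    (hpos : ∀ t ∈ Icc (0:ℝ) 1, IsStrictlyPositive (P t)) (hle : P 1 ≤ 1) :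
    (∫ t in (0:ℝ)..1, φ (Ring.inverse (P t) * P' t)).re ≤ 0 := by
  have h1 : (1:ℝ) ∈ Icc (0:ℝ) 1 := by simp
  have hu : ∀ u ∈ Icc (0 : ℝ) 1, ∀ t ∈ Icc (0 : ℝ) 1, IsStrictlyPositive (1 + u • (P t - 1)) :=
    fun u hu t ht => isStrictlyPositive_convex (hpos t ht) hu
  rw [integral_logDeriv_eq hφ hP fun u hu' t ht => (hu u hu' t ht).isUnit]
  have hc : ContinuousOn (fun u : ℝ => φ (Ring.inverse (1 + u • (P 1 - 1)) * (P 1 - 1)))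
      (uIcc 0 1) := by
    rw [uIcc_of_le zero_le_one]
    exact φ.continuous.comp_continuousOn ((continuousOn_ringInverse
      (continuousOn_const.add (continuousOn_id.smul continuousOn_const))
      (fun u hu' => (hu u hu' 1 h1).isUnit)).mul continuousOn_const)
  have hre := Complex.reCLM.intervalIntegral_comp_comm (hc.intervalIntegrable (μ := volume))
  simp only [Complex.reCLM_apply] at hre
  rw [← hre, ← neg_nonneg, ← intervalIntegral.integral_neg]
  refine intervalIntegral.integral_nonneg zero_le_one fun u hu' => ?_
  rw [← Complex.neg_re, ← map_neg, ← mul_neg, neg_sub]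
  exact trace_mul_nonneg hφ (ringInverse_nonneg (hu u hu' 1 h1)) (sub_nonneg.2 hle)

/-- The trace of the logarithmic derivative is additive under products. -/
lemma logDeriv_mul (hφ : IsFaithfulTracialState (φ : A →ₗ[ℂ] ℂ)) {x y : A} (x' y' : A)
    (hx : IsUnit x) (hy : IsUnit y) :
    φ (Ring.inverse (x * y) * (x' * y + x * y')) =
      φ (Ring.inverse x * x') + φ (Ring.inverse y * y') := by
  have e : Ring.inverse (x * y) = Ring.inverse y * Ring.inverse x := by
    obtain ⟨u, rfl⟩ := hx
    obtain ⟨v, rfl⟩ := hy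
    rw [← Units.val_mul, Ring.inverse_unit, Ring.inverse_unit, Ring.inverse_unit, mul_inv_rev,
      Units.val_mul]
  have e1 : Ring.inverse y * Ring.inverse x * (x' * y) =
      Ring.inverse y * (Ring.inverse x * x' * y) := by simp only [mul_assoc]
  have e2 : Ring.inverse y * Ring.inverse x * (x * y') = Ring.inverse y * y' := by
    rw [mul_assoc, ← mul_assoc (Ring.inverse x), Ring.inverse_mul_cancel _ hx, one_mul]
  rw [e, mul_add, map_add, e1, e2, trace_mul_comm hφ (Ring.inverse y), mul_assoc,
    Ring.mul_inverse_cancel _ hy, mul_one]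

lemma IsUnitPath.mul {R : Type*} [NormedRing R] [NormedAlgebra ℝ R] {F F' G G' : ℝ → R}
    (hF : IsUnitPath F F') (hG : IsUnitPath G G') :
    IsUnitPath (fun t => F t * G t) (fun t => F' t * G t + F t * G' t) where
  hasDerivAt t ht := (hF.hasDerivAt t ht).mul (hG.hasDerivAt t ht)
  continuousOn_deriv := (hF.continuousOn_deriv.mul hG.continuousOn).add
    (hF.continuousOn.mul hG.continuousOn_deriv)
  isUnit t ht := (hF.isUnit t ht).mul (hG.isUnit t ht)
  map_zero := by simp [hF.map_zero, hG.map_zero]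

lemma IsUnitPath.star {F F' : ℝ → A} (hF : IsUnitPath F F') :
    IsUnitPath (fun t => star (F t)) (fun t => star (F' t)) where
  hasDerivAt t ht := (hF.hasDerivAt t ht).star
  continuousOn_deriv := hF.continuousOn_deriv.star
  isUnit t ht := (hF.isUnit t ht).star
  map_zero := by simp [hF.map_zero]

lemma IsUnitPath.exists_pow (hφ : IsFaithfulTracialState (φ : A →ₗ[ℂ] ℂ)) {F F' : ℝ → A}
    (hF : IsUnitPath F F') (n : ℕ) :
    ∃ D : ℝ → A, IsUnitPath (fun t => F t ^ n) D ∧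
      ∀ t ∈ Icc (0:ℝ) 1, φ (Ring.inverse (F t ^ n) * D t) = n * φ (Ring.inverse (F t) * F' t) := by
  induction n with
  | zero =>
    refine ⟨fun _ => 0, ⟨fun t _ => ?_, continuousOn_const, by simp, by simp⟩, by simp⟩
    simpa using hasDerivAt_const t (1 : A)
  | succ n ih =>
    obtain ⟨D, hD, hD'⟩ := ih
    refine ⟨fun t => D t * F t + F t ^ n * F' t, ?_, fun t ht => ?_⟩
    · simpa only [pow_succ] using hD.mul hF
    · rw [pow_succ, logDeriv_mul hφ _ _ (hD.isUnit t ht) (hF.isUnit t ht), hD' t ht]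
      push_cast
      ring

lemma IsUnitPath.continuousOn_logDeriv {F F' : ℝ → A} (hF : IsUnitPath F F') :
    ContinuousOn (fun t => φ (Ring.inverse (F t) * F' t)) (Icc 0 1) :=
  φ.continuous.comp_continuousOn
    ((continuousOn_ringInverse hF.continuousOn hF.isUnit).mul hF.continuousOn_deriv)

lemma IsUnitPath.re_integral_logDeriv {F F' : ℝ → A} (hF : IsUnitPath F F') :
    (∫ t in (0:ℝ)..1, φ (Ring.inverse (F t) * F' t)).re =
      ∫ t in (0:ℝ)..1, (φ (Ring.inverse (F t) * F' t)).re := by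
  have hc : ContinuousOn (fun t => φ (Ring.inverse (F t) * F' t)) (uIcc 0 1) := by
    rw [uIcc_of_le zero_le_one]
    exact hF.continuousOn_logDeriv
  have hre := Complex.reCLM.intervalIntegral_comp_comm (hc.intervalIntegrable (μ := volume))
  simpa only [Complex.reCLM_apply] using hre.symm

/-- Apply the positive case to `star F * F`: its endpoint is at most 1, and its traced logarithmic
derivative has twice the real part of that of `F`. -/
lemma re_integral_logDeriv_nonpos_of_norm_le_one
    (hφ : IsFaithfulTracialState (φ : A →ₗ[ℂ] ℂ)) {F F' : ℝ → A} (hF : IsUnitPath F F')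
    (hle : ‖F 1‖ ≤ 1) :
    (∫ t in (0:ℝ)..1, φ (Ring.inverse (F t) * F' t)).re ≤ 0 := by
  let _ := CStarAlgebra.spectralOrder A
  have _ := CStarAlgebra.spectralOrderedRing A
  have hP := hF.star.mul hF
  have h := re_integral_logDeriv_nonpos_of_le_one hφ hP
    (fun t ht => (hP.isUnit t ht).isStrictlyPositive (star_mul_self_nonneg _)) ?_
  · have e : ∀ t ∈ uIcc (0:ℝ) 1,
        (φ (Ring.inverse (star (F t) * F t) * (star (F' t) * F t + star (F t) * F' t))).re =
        2 * (φ (Ring.inverse (F t) * F' t)).re := by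
      intro t ht
      rw [uIcc_of_le zero_le_one] at ht
      have hu := hF.isUnit t ht
      rw [logDeriv_mul hφ _ _ hu.star hu, Ring.inverse_star, trace_mul_comm hφ, ← star_mul,
        map_star hφ]
      simp
      ring
    rw [hP.re_integral_logDeriv, intervalIntegral.integral_congr e,
      intervalIntegral.integral_const_mul] at h
    rw [hF.re_integral_logDeriv]
    linarith
  · refine (CStarAlgebra.norm_le_one_iff_of_nonneg _ (star_mul_self_nonneg _)).mp ?_
    rw [CStarRing.norm_star_mul_self]
    exact mul_le_one₀ hle (norm_nonneg _) hle

/-- For a `C¹` path of units from `1` to an element of spectral radius `< 1`, the real part of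
the integral of the trace of the logarithmic derivative is nonpositive. -/
lemma re_integral_logDeriv_nonpos
    (hφ : IsFaithfulTracialState (φ : A →ₗ[ℂ] ℂ)) {F F' : ℝ → A} (hF : IsUnitPath F F')
    (hle : spectralRadius ℂ (F 1) < 1) :
    (∫ t in (0:ℝ)..1, φ (Ring.inverse (F t) * F' t)).re ≤ 0 := by
  -- Gelfand's formula supplies a power in the unit ball; passing to that power only multiplies the
  -- integral by `n`.
  obtain ⟨n, hn, hn0⟩ : ∃ n : ℕ, ‖F 1 ^ n‖ ≤ 1 ∧ 0 < n := by
    have h1 := (spectrum.pow_nnnorm_pow_one_div_tendsto_nhds_spectralRadius (F 1)).eventually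
      (gt_mem_nhds hle)
    obtain ⟨n, hn, hn0⟩ := (h1.and (Filter.eventually_gt_atTop 0)).exists
    refine ⟨n, ?_, hn0⟩
    by_contra! hcon
    refine absurd hn (not_lt.2 (ENNReal.one_le_rpow ?_ (by positivity)))
    exact_mod_cast hcon.le
  obtain ⟨D, hD, hD'⟩ := hF.exists_pow hφ n
  have h := re_integral_logDeriv_nonpos_of_norm_le_one hφ hD hn
  rw [intervalIntegral.integral_congr (g := fun t => (n:ℂ) * φ (Ring.inverse (F t) * F' t))
    (fun t ht => hD' t (by rwa [uIcc_of_le zero_le_one] at ht)),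
    intervalIntegral.integral_const_mul] at h
  have h2 : (n:ℝ) * (∫ t in (0:ℝ)..1, φ (Ring.inverse (F t) * F' t)).re ≤ 0 := by simpa using h
  exact nonpos_of_mul_nonpos_right h2 (by exact_mod_cast hn0)

end

/-! ### Derivative bounds for holomorphic curves of units. -/

section


variable {A : Type*} [CStarAlgebra A] {φ : A →L[ℂ] ℂ}

/-- A scalar path with logarithmic derivative `-ℓ`, used to rescale an endpoint. -/
lemma isUnitPath_exp (ℓ : ℝ) :
    IsUnitPath (fun t : ℝ => Real.exp (-(ℓ * t)) • (1 : A))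
      (fun t : ℝ => Real.exp (-(ℓ * t)) • (1 : A) * (-ℓ) • (1 : A)) where
  hasDerivAt t _ := by
    have h : HasDerivAt (fun t : ℝ => Real.exp (-(ℓ * t))) (Real.exp (-(ℓ * t)) * (-ℓ)) t := by
      simpa using ((hasDerivAt_id t).const_mul ℓ).neg.exp
    simpa only [smul_mul_smul_comm, one_mul] using h.smul_const (1 : A)
  continuousOn_deriv := by fun_prop
  isUnit t _ := by
    rw [← Algebra.algebraMap_eq_smul_one]
    exact (isUnit_iff_ne_zero.mpr (Real.exp_ne_zero _)).map (algebraMap ℝ A)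
  map_zero := by simp

lemma spectralRadius_smul_lt_one [Nontrivial A] {x : A} {M : ℝ} (hM : 0 < M)
    (hx : ∀ w ∈ spectrum ℂ x, ‖w‖ < M) : spectralRadius ℂ (M⁻¹ • x) < 1 := by
  refine spectrum.spectralRadius_lt_of_forall_lt_of_nonempty (spectrum.nonempty _)
    (r := 1) fun k hk => ?_
  have e : M⁻¹ • x = Units.mk0 ((M⁻¹ : ℝ) : ℂ) (by simpa using hM.ne') • x := by
    rw [Units.smul_def, Units.val_mk0, Complex.coe_smul]
  rw [e, spectrum.unit_smul_eq_smul] at hk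
  obtain ⟨w, hw, rfl⟩ := hk
  have := hx w hw
  rw [← NNReal.coe_lt_coe, coe_nnnorm]
  simp only [Units.val_mk0, smul_eq_mul, norm_mul, Complex.norm_real, norm_inv,
    Real.norm_eq_abs, abs_of_pos hM, NNReal.coe_one]
  rwa [inv_mul_lt_iff₀ hM, mul_one]

/-- The primitive of `φ (F⁻¹ F')` has real part bounded by the logarithm of the spectral radius. -/
lemma re_le_log (hφ : IsFaithfulTracialState (φ : A →ₗ[ℂ] ℂ)) {F F₁ : ℂ → A} {h : ℂ → ℂ}
    {R M : ℝ} (hF : ∀ z ∈ Metric.ball (0:ℂ) R, HasDerivAt F (F₁ z) z)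
    (hF₁ : ContinuousOn F₁ (Metric.ball 0 R))
    (hu : ∀ z ∈ Metric.ball (0:ℂ) R, IsUnit (F z)) (h0 : F 0 = 1) (hM : 0 < M)
    (hs : ∀ z ∈ Metric.ball (0:ℂ) R, ∀ w ∈ spectrum ℂ (F z), ‖w‖ < M)
    (hh : ∀ z ∈ Metric.ball (0:ℂ) R, HasDerivAt h (φ (Ring.inverse (F z) * F₁ z)) z)
    (hh0 : h 0 = 0) {z : ℂ} (hz : z ∈ Metric.ball (0:ℂ) R) : (h z).re ≤ Real.log M := by
  have : Nontrivial A := by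
    by_contra hA
    rw [not_nontrivial_iff_subsingleton] at hA
    have h1 := hφ.map_one
    rw [Subsingleton.elim (1 : A) 0] at h1
    simp at h1
  have hmem : ∀ t ∈ Icc (0:ℝ) 1, (t:ℂ) * z ∈ Metric.ball (0:ℂ) R := by
    intro t ht
    rw [mem_ball_zero_iff] at hz ⊢
    rw [norm_mul, Complex.norm_real, Real.norm_eq_abs, abs_of_nonneg ht.1]
    exact (mul_le_of_le_one_left (norm_nonneg _) ht.2).trans_lt hz
  have hlin : ∀ t : ℝ, HasDerivAt (fun t : ℝ => (t:ℂ) * z) z t := fun t => by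
    simpa using (Complex.ofRealCLM.hasDerivAt (x := t)).mul_const z
  have hlc : Continuous fun t : ℝ => (t:ℂ) * z := by fun_prop
  have hG : IsUnitPath (fun t : ℝ => F (t * z)) (fun t : ℝ => z • F₁ (t * z)) :=
    { hasDerivAt := fun t ht => (hF _ (hmem t ht)).scomp t (hlin t)
      continuousOn_deriv := (hF₁.comp hlc.continuousOn hmem).const_smul z
      isUnit := fun t ht => hu _ (hmem t ht)
      map_zero := by simp [h0] }
  have hE := isUnitPath_exp (A := A) (Real.log M)
  -- With `ℓ = log M` the product path ends at `M⁻¹ • F z`, of spectral radius below 1; the scalar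
  -- factor contributes exactly `-log M`.
  have hmain := re_integral_logDeriv_nonpos hφ (hE.mul hG) (by
    simp only [mul_one, Complex.ofReal_one, one_mul, smul_mul_assoc, Real.exp_neg,
      Real.exp_log hM]
    exact spectralRadius_smul_lt_one hM (hs z hz))
  have e : ∀ t ∈ uIcc (0:ℝ) 1,
      φ (Ring.inverse (Real.exp (-(Real.log M * t)) • (1 : A) * F (t * z)) *
        ((Real.exp (-(Real.log M * t)) • (1 : A) * (-Real.log M) • (1 : A)) * F (t * z) +
          Real.exp (-(Real.log M * t)) • (1 : A) * z • F₁ (t * z))) =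
      -(Real.log M : ℂ) + φ (Ring.inverse (F (t * z)) * z • F₁ (t * z)) := by
    intro t ht
    rw [uIcc_of_le zero_le_one] at ht
    rw [logDeriv_mul hφ _ _ (hE.isUnit t ht) (hG.isUnit t ht), ← mul_assoc,
      Ring.inverse_mul_cancel _ (hE.isUnit t ht), one_mul, ← Complex.coe_smul, map_smul]
    have h1 : φ 1 = 1 := hφ.map_one
    simp [h1]
  have hc : ContinuousOn (fun t : ℝ => φ (Ring.inverse (F (t * z)) * z • F₁ (t * z)))
      (uIcc 0 1) := by
    rw [uIcc_of_le zero_le_one]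
    exact hG.continuousOn_logDeriv
  have hint : ∫ t in (0:ℝ)..1, φ (Ring.inverse (F (t * z)) * z • F₁ (t * z)) = h z := by
    rw [intervalIntegral.integral_eq_sub_of_hasDerivAt (f := fun t : ℝ => h (t * z))
      (fun t ht => ?_) hc.intervalIntegrable]
    · simp [hh0]
    · rw [uIcc_of_le zero_le_one] at ht
      have h2 := (hh _ (hmem t ht)).scomp t (hlin t)
      rwa [mul_smul_comm, map_smul]
  rw [intervalIntegral.integral_congr e, intervalIntegral.integral_add
    intervalIntegrable_const hc.intervalIntegrable, hint] at hmain
  simp at hmain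
  linarith

/-- Estimates at the origin for the second and third derivatives of the logarithmic trace of a
holomorphic curve of units. -/
lemma norm_jet_le (hφ : IsFaithfulTracialState (φ : A →ₗ[ℂ] ℂ)) {F F₁ F₂ F₃ : ℂ → A}
    {R M : ℝ} (hF : ∀ z, HasDerivAt F (F₁ z) z) (hF₁ : ∀ z, HasDerivAt F₁ (F₂ z) z)
    (hF₂ : ∀ z, HasDerivAt F₂ (F₃ z) z) (hR : 0 < R)
    (hu : ∀ z ∈ Metric.ball (0:ℂ) R, IsUnit (F z)) (h0 : F 0 = 1) (hM : 1 < M)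
    (hs : ∀ z ∈ Metric.ball (0:ℂ) R, ∀ w ∈ spectrum ℂ (F z), ‖w‖ < M) :
    ‖φ (F₂ 0 - F₁ 0 ^ 2)‖ ≤ 16 * Real.log M / R ^ 2 ∧
      ‖φ (F₃ 0 - 3 • (F₁ 0 * F₂ 0) + 2 • F₁ 0 ^ 3)‖ ≤ 96 * Real.log M / R ^ 3 := by
  set g : ℂ → ℂ := fun z => φ (Ring.inverse (F z) * F₁ z) with hg
  set g₁ : ℂ → ℂ := fun z => φ (-(Ring.inverse (F z) * F₁ z * Ring.inverse (F z)) * F₁ z +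
    Ring.inverse (F z) * F₂ z) with hg₁
  have hI : ∀ z ∈ Metric.ball (0:ℂ) R, HasDerivAt (fun z => Ring.inverse (F z))
      (-(Ring.inverse (F z) * F₁ z * Ring.inverse (F z))) z :=
    fun z hz => hasDerivAt_ringInverse (hF z) (hu z hz)
  have hgd : ∀ z ∈ Metric.ball (0:ℂ) R, HasDerivAt g (g₁ z) z := fun z hz =>
    φ.hasFDerivAt.comp_hasDerivAt z ((hI z hz).mul (hF₁ z))
  have h0R : (0:ℂ) ∈ Metric.ball (0:ℂ) R := Metric.mem_ball_self hR
  have hI0 := hI 0 h0R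
  have hg₁d : HasDerivAt g₁ (φ (F₃ 0 - 3 • (F₁ 0 * F₂ 0) + 2 • F₁ 0 ^ 3)) 0 := by
    have := φ.hasFDerivAt.comp_hasDerivAt 0
      ((((hI0.mul (hF₁ 0)).mul hI0).neg.mul (hF₁ 0)).add (hI0.mul (hF₂ 0)))
    refine this.congr_deriv ?_
    simp only [h0, Ring.inverse_one, one_mul, mul_one, map_add, map_sub, map_nsmul, neg_mul,
      mul_neg, map_neg, neg_add, add_mul, neg_neg, pow_succ, pow_zero,
      trace_mul_comm hφ (F₂ 0) (F₁ 0), Pi.mul_apply, Pi.neg_apply]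
    simp only [nsmul_eq_mul]
    push_cast
    ring
  -- `h` plays the role of the logarithm of the determinant of `F`, normalized at the origin.
  obtain ⟨h, hh0, hh⟩ := (DifferentiableOn.isExactOn_ball (f := g) (c := 0) (r := R)
    (fun z hz => (hgd z hz).differentiableAt.differentiableWithinAt)).with_val_at 0 0
  have hd : DifferentiableOn ℂ h (Metric.ball 0 R) :=
    fun z hz => (hh z hz).differentiableAt.differentiableWithinAt
  have hlog : 0 < Real.log M := Real.log_pos hM
  have hre : MapsTo h (Metric.ball 0 R) {z | z.re ≤ Real.log M} := fun z hz =>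
    re_le_log hφ (fun z _ => hF z) (fun z _ => (hF₁ z).continuousAt.continuousWithinAt) hu h0
      (by linarith) hs hh hh0 hz
  -- On the circle of radius `R / 2` Borel–Carathéodory gives `2 log M`; Cauchy's estimates there
  -- multiply it by `2! · 4 / R ^ 2` and `3! · 8 / R ^ 3`, whence 16 and 96.
  have hb : ∀ z ∈ Metric.sphere (0:ℂ) (R / 2), ‖h z‖ ≤ 2 * Real.log M := by
    intro z hz
    rw [mem_sphere_zero_iff_norm] at hz
    have := Complex.borelCaratheodory_zero hlog hd hre hR
      (mem_ball_zero_iff.2 (by rw [hz]; linarith)) hh0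
    rw [hz] at this
    refine this.trans_eq ?_
    field_simp
    ring
  have hdc : DiffContOnCl ℂ h (Metric.ball 0 (R / 2)) :=
    (hd.mono ((Metric.closure_ball_subset_closedBall).trans
      (Metric.closedBall_subset_ball (by linarith)))).diffContOnCl
  have hev : ∀ᶠ z in nhds (0:ℂ), z ∈ Metric.ball (0:ℂ) R := Metric.ball_mem_nhds 0 hR
  have e1 : deriv h =ᶠ[nhds 0] g := hev.mono fun z hz => (hh z hz).deriv
  have e2 : deriv g =ᶠ[nhds 0] g₁ := hev.mono fun z hz => (hgd z hz).deriv
  have i2 : iteratedDeriv 2 h 0 = φ (F₂ 0 - F₁ 0 ^ 2) := by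
    rw [iteratedDeriv_succ', e1.iteratedDeriv_eq, iteratedDeriv_one, e2.eq_of_nhds]
    simp only [hg₁, h0, Ring.inverse_one, one_mul, mul_one, pow_two]
    congr 1
    noncomm_ring
  have i3 : iteratedDeriv 3 h 0 = φ (F₃ 0 - 3 • (F₁ 0 * F₂ 0) + 2 • F₁ 0 ^ 3) := by
    rw [iteratedDeriv_succ', e1.iteratedDeriv_eq, iteratedDeriv_succ', e2.iteratedDeriv_eq,
      iteratedDeriv_one, hg₁d.deriv]
  constructor
  · rw [← i2]
    refine (Complex.norm_iteratedDeriv_le_of_forall_mem_sphere_norm_le 2 (by positivity)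
      hdc hb).trans_eq ?_
    simp [Nat.factorial]
    field_simp
    ring
  · rw [← i3]
    refine (Complex.norm_iteratedDeriv_le_of_forall_mem_sphere_norm_le 3 (by positivity)
      hdc hb).trans_eq ?_
    simp [Nat.factorial]
    field_simp
    ring

end

/-! ### The principal component and its spectral control. -/

section


variable {A B : Type*} [CStarAlgebra A] {φ : A →L[ℂ] ℂ}
  [NormedRing B]

lemma mul_mem_principalComponent [CompleteSpace B] {x y : B} (hx : x ∈ principalComponent B)
    (hy : y ∈ principalComponent B) : x * y ∈ principalComponent B := by
  obtain ⟨u, hu, rfl⟩ := hx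
  obtain ⟨v, hv, rfl⟩ := hy
  exact ⟨u * v, (Subgroup.connectedComponentOfOne Bˣ).mul_mem hu hv, rfl⟩

lemma pow_mem_principalComponent [CompleteSpace B] {x : B} (hx : x ∈ principalComponent B)
    (n : ℕ) : x ^ n ∈ principalComponent B := by
  obtain ⟨u, hu, rfl⟩ := hx
  exact ⟨u ^ n, (Subgroup.connectedComponentOfOne Bˣ).pow_mem hu n, rfl⟩

lemma norm_one_add_pow_le {x : B} (hx : ‖x‖ ≤ 1) (n : ℕ) : ‖(1 + x) ^ n‖ ≤ ‖(1 : B)‖ * 2 ^ n := by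
  induction n with
  | zero => simp
  | succ n ih =>
    rw [pow_succ, mul_add, mul_one, pow_succ, ← mul_assoc, mul_two]
    exact (norm_add_le _ _).trans (add_le_add ih ((norm_mul_le _ _).trans
      ((mul_le_of_le_one_right (norm_nonneg _) hx).trans ih)))

variable [NormedAlgebra ℂ B]

lemma one_sub_mem_principalComponent [CompleteSpace B] {x : B} (hx : ‖x‖ < 1) :
    1 - x ∈ principalComponent B := by
  have hlt : ∀ t : Icc (0:ℝ) 1, ‖((t : ℝ) : ℂ) • x‖ < 1 := fun t => by
    rw [norm_smul, Complex.norm_real, Real.norm_eq_abs, abs_of_nonneg t.2.1]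
    exact (mul_le_of_le_one_left (norm_nonneg _) t.2.2).trans_lt hx
  let γ : Icc (0:ℝ) 1 → Bˣ := fun t => Units.oneSub (((t : ℝ) : ℂ) • x) (hlt t)
  have hγ : Continuous γ := by
    rw [Units.isOpenEmbedding_val.isEmbedding.continuous_iff]
    change Continuous fun t : Icc (0:ℝ) 1 => 1 - ((t : ℝ) : ℂ) • x
    fun_prop
  have h0 : (1 : Bˣ) ∈ range γ := ⟨⟨0, by simp⟩, by ext; simp [γ]⟩
  have hsub := (isPreconnected_range hγ).subset_connectedComponent h0
  exact ⟨γ ⟨1, by simp⟩, hsub ⟨_, rfl⟩, by simp [γ]⟩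

/-- A linear map sending the principal component to units does not enlarge spectra beyond the
norm. -/
lemma norm_le_of_mem_spectrum [CompleteSpace B] {T : B →ₗ[ℂ] A} (hone : T 1 = 1)
    (hT : ∀ b ∈ principalComponent B, IsUnit (T b)) {y : B} {w : ℂ}
    (hw : w ∈ spectrum ℂ (T y)) : ‖w‖ ≤ ‖y‖ := by
  by_contra! hlt
  have hw0 : w ≠ 0 := by
    rintro rfl
    simp at hlt
    exact absurd hlt (norm_nonneg y).not_gt
  have h1 : ‖w⁻¹ • y‖ < 1 := by
    rw [norm_smul, norm_inv, inv_mul_lt_iff₀ (norm_pos_iff.2 hw0), mul_one]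
    exact hlt
  have h2 := hT _ (one_sub_mem_principalComponent h1)
  rw [map_sub, hone, map_smul] at h2
  refine hw ?_
  have e : algebraMap ℂ A w - T y = algebraMap ℂ A w * (1 - w⁻¹ • T y) := by
    rw [mul_sub, mul_one, ← Algebra.smul_def, smul_smul, mul_inv_cancel₀ hw0, one_smul]
  rw [spectrum.mem_resolventSet_iff, e]
  exact ((isUnit_iff_ne_zero.2 hw0).map (algebraMap ℂ A)).mul h2

/-! ### Polynomial curves, on which `T` acts coefficientwise without continuity. -/

/-- Polynomial curves in a complex algebra. -/
def polyCurve (B : Type*) [Ring B] [Algebra ℂ B] : Submodule ℂ (ℂ → B) :=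
  Submodule.span ℂ {f | ∃ (k : ℕ) (c : B), f = fun z => z ^ k • c}

lemma monomial_mem_polyCurve (k : ℕ) (c : B) : (fun z : ℂ => z ^ k • c) ∈ polyCurve B :=
  Submodule.subset_span ⟨k, c, rfl⟩

lemma mul_mem_polyCurve {p q : ℂ → B} (hp : p ∈ polyCurve B) (hq : q ∈ polyCurve B) :
    p * q ∈ polyCurve B := by
  have h := Submodule.mul_mem_mul hp hq
  rw [polyCurve, Submodule.span_mul_span] at h
  refine Submodule.span_mono ?_ h
  rintro _ ⟨_, ⟨k, c, rfl⟩, _, ⟨l, d, rfl⟩, rfl⟩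
  refine ⟨k + l, c * d, ?_⟩
  ext z
  simp [pow_add, smul_smul, mul_comm]

lemma one_mem_polyCurve : (1 : ℂ → B) ∈ polyCurve B := by
  simpa [Pi.one_def] using monomial_mem_polyCurve 0 (1 : B)

lemma pow_mem_polyCurve {p : ℂ → B} (hp : p ∈ polyCurve B) (n : ℕ) : p ^ n ∈ polyCurve B := by
  induction n with
  | zero => simpa using one_mem_polyCurve
  | succ n ih => simpa [pow_succ] using mul_mem_polyCurve ih hp

lemma hasDerivAt_monomial {E : Type*} [NormedAddCommGroup E] [NormedSpace ℂ E] (k : ℕ) (c : E)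
    (z : ℂ) : HasDerivAt (fun z : ℂ => z ^ k • c) (z ^ (k - 1) • (k : ℂ) • c) z := by
  simpa [smul_smul, mul_comm] using (hasDerivAt_pow k z).smul_const c

/-- A polynomial curve has a polynomial derivative, which any linear map preserves. -/
lemma exists_hasDerivAt_of_mem_polyCurve {E : Type*} [NormedAddCommGroup E] [NormedSpace ℂ E]
    (T : B →ₗ[ℂ] E) {p : ℂ → B} (hp : p ∈ polyCurve B) :
    ∃ q ∈ polyCurve B, (∀ z, HasDerivAt p (q z) z) ∧
      ∀ z, HasDerivAt (fun z => T (p z)) (T (q z)) z := by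
  induction hp using Submodule.span_induction with
  | mem p h =>
    obtain ⟨k, c, rfl⟩ := h
    refine ⟨fun z => z ^ (k - 1) • (k : ℂ) • c, monomial_mem_polyCurve _ _,
      hasDerivAt_monomial k c, fun z => ?_⟩
    simpa using hasDerivAt_monomial k (T c) z
  | zero =>
    exact ⟨0, zero_mem _, fun z => hasDerivAt_const z 0, fun z => by
      simpa using hasDerivAt_const z (0 : E)⟩
  | add p p' _ _ h h' =>
    obtain ⟨q, hq, h1, h2⟩ := h
    obtain ⟨q', hq', h1', h2'⟩ := h'
    exact ⟨q + q', add_mem hq hq', fun z => (h1 z).add (h1' z), fun z => by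
      simpa [Pi.add_def] using (h2 z).add (h2' z)⟩
  | smul c p _ h =>
    obtain ⟨q, hq, h1, h2⟩ := h
    exact ⟨c • q, Submodule.smul_mem _ c hq, fun z => (h1 z).const_smul c, fun z => by
      simpa [Pi.smul_def] using (h2 z).const_smul c⟩

/-- Uniqueness of derivatives lets an explicit formula for the derivative be used directly. -/
lemma hasDerivAt_of_mem_polyCurve {E : Type*} [NormedAddCommGroup E] [NormedSpace ℂ E]
    (T : B →ₗ[ℂ] E) {p q : ℂ → B} (hp : p ∈ polyCurve B) (hq : ∀ z, HasDerivAt p (q z) z) :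
    q ∈ polyCurve B ∧ ∀ z, HasDerivAt (fun z => T (p z)) (T (q z)) z := by
  obtain ⟨r, hr, h1, h2⟩ := exists_hasDerivAt_of_mem_polyCurve T hp
  obtain rfl : q = r := funext fun z => (hq z).unique (h1 z)
  exact ⟨hr, h2⟩

/-- Jet estimates for the image of a polynomial curve in the principal component. -/
lemma norm_jet_map_le [CompleteSpace B] (hφ : IsFaithfulTracialState (φ : A →ₗ[ℂ] ℂ))
    {T : B →ₗ[ℂ] A} (hone : T 1 = 1) (hT : ∀ b ∈ principalComponent B, IsUnit (T b))
    {p p₁ p₂ p₃ : ℂ → B} {R M : ℝ} (hp : p ∈ polyCurve B) (hd : ∀ z, HasDerivAt p (p₁ z) z)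
    (hd₁ : ∀ z, HasDerivAt p₁ (p₂ z) z) (hd₂ : ∀ z, HasDerivAt p₂ (p₃ z) z) (hR : 0 < R)
    (h0 : p 0 = 1) (hM : 1 < M) (hmem : ∀ z ∈ Metric.ball (0:ℂ) R, p z ∈ principalComponent B)
    (hlt : ∀ z ∈ Metric.ball (0:ℂ) R, ‖p z‖ < M) :
    ‖φ (T (p₂ 0) - T (p₁ 0) ^ 2)‖ ≤ 16 * Real.log M / R ^ 2 ∧
      ‖φ (T (p₃ 0) - 3 • (T (p₁ 0) * T (p₂ 0)) + 2 • T (p₁ 0) ^ 3)‖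
        ≤ 96 * Real.log M / R ^ 3 := by
  obtain ⟨hp₁, hF⟩ := hasDerivAt_of_mem_polyCurve T hp hd
  obtain ⟨hp₂, hF₁⟩ := hasDerivAt_of_mem_polyCurve T hp₁ hd₁
  obtain ⟨-, hF₂⟩ := hasDerivAt_of_mem_polyCurve T hp₂ hd₂
  exact norm_jet_le hφ hF hF₁ hF₂ hR (fun z hz => hT _ (hmem z hz)) (by rw [h0, hone]) hM
    fun z hz w hw => (norm_le_of_mem_spectrum hone hT hw).trans_lt (hlt z hz)

lemma hasDerivAt_one_add_smul_pow (w : B) (m : ℕ) (z : ℂ) :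
    HasDerivAt (fun z : ℂ => (1 + z • w) ^ (m + 1)) (((m : ℂ) + 1) • (w * (1 + z • w) ^ m)) z := by
  have h1 : HasDerivAt (fun z : ℂ => 1 + z • w) w z := by
    simpa using ((hasDerivAt_id z).smul_const w).const_add 1
  induction m with
  | zero => simpa using h1
  | succ m ih =>
    have hc : Commute w (1 + z • w) :=
      (Commute.one_right w).add_right ((Commute.refl w).smul_right z)
    have h2 := ih.mul h1
    refine (h2.congr_of_eventuallyEq (.of_forall fun z => ?_)).congr_deriv ?_
    · simp [pow_succ]
    · rw [smul_mul_assoc, mul_assoc, ← pow_succ, (hc.pow_right (m + 1)).eq.symm]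
      push_cast
      module

lemma one_add_smul_pow_mem_polyCurve (w : B) (n : ℕ) :
    (fun z : ℂ => (1 + z • w) ^ n) ∈ polyCurve B := by
  have h : (fun z : ℂ => 1 + z • w) ∈ polyCurve B := by
    simpa [Pi.one_def, Pi.add_def] using add_mem one_mem_polyCurve (monomial_mem_polyCurve 1 w)
  exact pow_mem_polyCurve h n

lemma one_add_mem_principalComponent [CompleteSpace B] {x : B} (hx : ‖x‖ < 1) :
    1 + x ∈ principalComponent B := by
  simpa using one_sub_mem_principalComponent (x := -x) (by simpa using hx)

end

/-! ### Passage to the limit and the trace identities. -/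

section


variable {A B : Type*} [CStarAlgebra A] {φ : A →L[ℂ] ℂ}
  [NormedRing B] [NormedAlgebra ℂ B] [CompleteSpace B]

lemma eq_zero_of_norm_add_le {X Y Z : ℂ} {C : ℝ}
    (h : ∀ N : ℕ, ‖X + ((N : ℂ) + 3)⁻¹ * Y + ((N : ℂ) + 3)⁻¹ ^ 2 * Z‖ ≤ C * ((N : ℝ) + 3)⁻¹) :
    X = 0 := by
  have h1 : Tendsto (fun N : ℕ => ((N : ℝ) + 3)⁻¹) atTop (𝓝 0) :=
    tendsto_inv_atTop_zero.comp (tendsto_atTop_add_const_right _ _ tendsto_natCast_atTop_atTop)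
  have h2 : Tendsto (fun N : ℕ => ((N : ℂ) + 3)⁻¹) atTop (𝓝 0) := by
    have := (Complex.continuous_ofReal.tendsto 0).comp h1
    simpa [Function.comp_def] using this
  have h3 : Tendsto (fun N : ℕ => X + ((N : ℂ) + 3)⁻¹ * Y + ((N : ℂ) + 3)⁻¹ ^ 2 * Z) atTop
      (𝓝 X) := by
    simpa using (tendsto_const_nhds.add (h2.mul_const Y)).add ((h2.pow 2).mul_const Z)
  have h4 := le_of_tendsto_of_tendsto' h3.norm (h1.const_mul C) h
  rw [mul_zero] at h4
  exact norm_le_zero_iff.1 h4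

lemma log_mul_four_pow_le {c : ℝ} (hc : 1 ≤ c) (N : ℕ) :
    Real.log (c * 4 ^ (N + 3)) ≤ (Real.log c + Real.log 4) * ((N : ℝ) + 3) := by
  rw [Real.log_mul (by positivity) (by positivity), Real.log_pow, add_mul]
  push_cast
  have := Real.log_nonneg hc
  nlinarith [(Nat.cast_nonneg N : (0:ℝ) ≤ N)]

/-- Jet estimates for the curve `(1 + z a / n) ^ n (1 + z b / n) ^ n`, with `n = N + 3`. -/
lemma exists_norm_jet_le (hφ : IsFaithfulTracialState (φ : A →ₗ[ℂ] ℂ))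
    {T : B →ₗ[ℂ] A} (hone : T 1 = 1) (hT : ∀ b ∈ principalComponent B, IsUnit (T b)) (a b : B) :
    ∃ C : ℝ, ∀ (N : ℕ) (p₁ p₂ p₃ : ℂ → B),
      (∀ z, HasDerivAt (fun z : ℂ => (1 + z • ((N : ℂ) + 3)⁻¹ • a) ^ (N + 3) *
        (1 + z • ((N : ℂ) + 3)⁻¹ • b) ^ (N + 3)) (p₁ z) z) →
      (∀ z, HasDerivAt p₁ (p₂ z) z) → (∀ z, HasDerivAt p₂ (p₃ z) z) →
      ‖φ (T (p₂ 0) - T (p₁ 0) ^ 2)‖ ≤ C * ((N : ℝ) + 3)⁻¹ ∧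
      ‖φ (T (p₃ 0) - 3 • (T (p₁ 0) * T (p₂ 0)) + 2 • T (p₁ 0) ^ 3)‖ ≤ C * ((N : ℝ) + 3)⁻¹ := by
  -- `K` strictly exceeds both norms, so `R = n / K` keeps `z a / n` and `z b / n` in the open unit
  -- ball.
  set K : ℝ := ‖a‖ + ‖b‖ + 1 with hK
  have hK1 : 1 ≤ K := by have := norm_nonneg a; have := norm_nonneg b; linarith
  -- `‖1‖ = 1` is not assumed; the added 1 gives `1 ≤ c` and a strict norm bound.
  set c : ℝ := ‖(1 : B)‖ ^ 2 + 1 with hc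
  have hc1 : 1 ≤ c := by have := sq_nonneg ‖(1 : B)‖; linarith
  set D : ℝ := Real.log c + Real.log 4 with hD
  have hD0 : 0 ≤ D := add_nonneg (Real.log_nonneg hc1) (Real.log_nonneg (by norm_num))
  refine ⟨96 * D * K ^ 3, fun N p₁ p₂ p₃ h1 h2 h3 => ?_⟩
  have hn : (1:ℝ) ≤ (N : ℝ) + 3 := by have := (Nat.cast_nonneg N : (0:ℝ) ≤ N); linarith
  have hn0 : (0:ℝ) < (N : ℝ) + 3 := by linarith
  set R : ℝ := ((N : ℝ) + 3) / K with hR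
  have hRpos : 0 < R := by positivity
  have hnn : ‖((N : ℂ) + 3)⁻¹‖ = ((N : ℝ) + 3)⁻¹ := by
    rw [norm_inv]
    congr 1
    have : ((N : ℂ) + 3) = (((N : ℝ) + 3 : ℝ) : ℂ) := by push_cast; rfl
    rw [this, Complex.norm_real, Real.norm_of_nonneg hn0.le]
  have hsmall : ∀ x : B, ‖x‖ < K → ∀ z ∈ Metric.ball (0:ℂ) R,
      ‖z • ((N : ℂ) + 3)⁻¹ • x‖ < 1 := by
    intro x hx z hz
    rw [mem_ball_zero_iff] at hz
    rw [norm_smul, norm_smul, hnn]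
    have hK0 : 0 < K := by linarith
    calc ‖z‖ * (((N : ℝ) + 3)⁻¹ * ‖x‖) ≤ R * (((N : ℝ) + 3)⁻¹ * ‖x‖) := by gcongr
      _ < R * (((N : ℝ) + 3)⁻¹ * K) := by gcongr
      _ = 1 := by rw [hR]; field_simp
  have ha := hsmall a (by have := norm_nonneg b; linarith)
  have hb := hsmall b (by have := norm_nonneg a; linarith)
  have key := norm_jet_map_le hφ hone hT (R := R) (M := c * 4 ^ (N + 3))
    (mul_mem_polyCurve (one_add_smul_pow_mem_polyCurve (((N : ℂ) + 3)⁻¹ • a) (N + 3))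
      (one_add_smul_pow_mem_polyCurve (((N : ℂ) + 3)⁻¹ • b) (N + 3)))
    h1 h2 h3 hRpos (by simp) ?_ ?_ ?_
  · have hlog : Real.log (c * 4 ^ (N + 3)) ≤ D * ((N : ℝ) + 3) := log_mul_four_pow_le hc1 N
    constructor
    · refine key.1.trans ?_
      calc 16 * Real.log (c * 4 ^ (N + 3)) / R ^ 2 ≤ 16 * (D * ((N : ℝ) + 3)) / R ^ 2 := by gcongr
        _ = 16 * D * K ^ 2 * ((N : ℝ) + 3)⁻¹ := by rw [hR]; field_simp
        _ ≤ 96 * D * K ^ 3 * ((N : ℝ) + 3)⁻¹ := by gcongr <;> norm_num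
    · refine key.2.trans ?_
      calc 96 * Real.log (c * 4 ^ (N + 3)) / R ^ 3 ≤ 96 * (D * ((N : ℝ) + 3)) / R ^ 3 := by gcongr
        _ = 96 * D * K ^ 3 * (((N : ℝ) + 3)⁻¹ * ((N : ℝ) + 3)⁻¹) := by rw [hR]; field_simp
        _ ≤ 96 * D * K ^ 3 * (((N : ℝ) + 3)⁻¹ * 1) := by gcongr; exact inv_le_one_of_one_le₀ hn
        _ = _ := by rw [mul_one]
  · exact one_lt_mul_of_le_of_lt hc1 (one_lt_pow₀ (by norm_num) (by omega))
  · exact fun z hz => mul_mem_principalComponent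
      (pow_mem_principalComponent (one_add_mem_principalComponent (ha z hz)) _)
      (pow_mem_principalComponent (one_add_mem_principalComponent (hb z hz)) _)
  · intro z hz
    have e : (2:ℝ) ^ (N + 3) * 2 ^ (N + 3) = 4 ^ (N + 3) := by rw [← mul_pow]; norm_num
    calc _ ≤ ‖(1:B)‖ * 2 ^ (N + 3) * (‖(1:B)‖ * 2 ^ (N + 3)) :=
          (norm_mul_le _ _).trans (mul_le_mul (norm_one_add_pow_le (ha z hz).le _)
            (norm_one_add_pow_le (hb z hz).le _) (norm_nonneg _) (by positivity))
      _ = ‖(1:B)‖ ^ 2 * 4 ^ (N + 3) := by rw [← e]; ring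
      _ < c * 4 ^ (N + 3) := by gcongr; linarith

/-- At 0 the curve has second derivative `(1 - 1/n) (a ^ 2 + b ^ 2) + 2 a b`; the `1/n` term is the
`Y` below. -/
lemma trace_map_sq (hφ : IsFaithfulTracialState (φ : A →ₗ[ℂ] ℂ))
    {T : B →ₗ[ℂ] A} (hone : T 1 = 1) (hT : ∀ b ∈ principalComponent B, IsUnit (T b)) (a b : B) :
    φ (T (a ^ 2 + (2:ℂ) • (a * b) + b ^ 2) - T (a + b) ^ 2) = 0 := by
  obtain ⟨C, hC⟩ := exists_norm_jet_le hφ hone hT a b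
  refine eq_zero_of_norm_add_le (Y := -φ (T (a ^ 2 + b ^ 2))) (Z := 0) (C := C) fun N => ?_
  have hn : (N : ℂ) + 3 ≠ 0 := by exact_mod_cast (by omega : N + 3 ≠ 0)
  set w := ((N : ℂ) + 3)⁻¹ • a with hw
  set v := ((N : ℂ) + 3)⁻¹ • b with hv
  have hd (x : B) (z : ℂ) := hasDerivAt_one_add_smul_pow x (N + 2) z
  have hd₁ (x : B) (z : ℂ) :=
    ((hasDerivAt_one_add_smul_pow x (N + 1) z).const_mul x).const_smul (((N + 2 : ℕ) : ℂ) + 1)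
  have hp₁ (z : ℂ) := (hd w z).mul (hd v z)
  have hp₂ (z : ℂ) := ((hd₁ w z).mul (hd v z)).add ((hd w z).mul (hd₁ v z))
  obtain ⟨hm, -⟩ := hasDerivAt_of_mem_polyCurve T (mul_mem_polyCurve
    (one_add_smul_pow_mem_polyCurve w (N + 3)) (one_add_smul_pow_mem_polyCurve v (N + 3))) hp₁
  obtain ⟨hm₂, -⟩ := hasDerivAt_of_mem_polyCurve T hm hp₂
  obtain ⟨q, -, hq, -⟩ := exists_hasDerivAt_of_mem_polyCurve T hm₂
  have key := (hC N _ _ _ hp₁ hp₂ hq).1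
  convert key using 2
  simp only [zero_smul, add_zero, one_pow, mul_one, one_mul, Pi.smul_apply, hw, hv]
  simp only [pow_two, smul_mul_assoc, mul_smul_comm, smul_smul, map_add, map_sub, map_smul,
    mul_add, add_mul, smul_eq_mul]
  push_cast
  field_simp
  ring

/-- With `b = 0` the second and third derivatives at 0 are `(1 - 1/n) a ^ 2` and `(1 - 3/n + 2/n ^
2) a ^ 3`, which determine `Y` and `Z`. -/
lemma trace_map_cube (hφ : IsFaithfulTracialState (φ : A →ₗ[ℂ] ℂ))
    {T : B →ₗ[ℂ] A} (hone : T 1 = 1) (hT : ∀ b ∈ principalComponent B, IsUnit (T b)) (a : B) :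
    φ (T (a ^ 3) - 3 • (T a * T (a ^ 2)) + 2 • T a ^ 3) = 0 := by
  obtain ⟨C, hC⟩ := exists_norm_jet_le hφ hone hT a 0
  refine eq_zero_of_norm_add_le (Y := 3 * φ (T a * T (a ^ 2)) - 3 * φ (T (a ^ 3)))
    (Z := 2 * φ (T (a ^ 3))) (C := C) fun N => ?_
  have hn : (N : ℂ) + 3 ≠ 0 := by exact_mod_cast (by omega : N + 3 ≠ 0)
  set w := ((N : ℂ) + 3)⁻¹ • a with hw
  have hd (z : ℂ) := hasDerivAt_one_add_smul_pow w (N + 2) z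
  have hd₁ (z : ℂ) :=
    ((hasDerivAt_one_add_smul_pow w (N + 1) z).const_mul w).const_smul (((N + 2 : ℕ) : ℂ) + 1)
  have hd₂ (z : ℂ) :=
    ((((hasDerivAt_one_add_smul_pow w N z).const_mul w).const_smul
      (((N + 1 : ℕ) : ℂ) + 1)).const_mul w).const_smul (((N + 2 : ℕ) : ℂ) + 1)
  have key := (hC N _ _ _ (by simpa using hd) hd₁ hd₂).2
  convert key using 2
  simp only [zero_smul, add_zero, one_pow, mul_one, Pi.smul_apply, hw]
  simp only [pow_succ, pow_zero, one_mul, smul_mul_assoc, mul_smul_comm, smul_smul, map_add,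
    map_sub, map_smul, map_nsmul, mul_assoc, smul_eq_mul]
  simp only [nsmul_eq_mul]
  push_cast
  field_simp
  ring

/-- `τ ∘ T` sees `T` as multiplicative. -/
lemma trace_map_mul (hφ : IsFaithfulTracialState (φ : A →ₗ[ℂ] ℂ))
    {T : B →ₗ[ℂ] A} (hone : T 1 = 1) (hT : ∀ b ∈ principalComponent B, IsUnit (T b)) (a b : B) :
    φ (T (a * b)) = φ (T a * T b) := by
  have h := trace_map_sq hφ hone hT a b
  -- Setting one variable to 0 gives the pure squares; subtracting them leaves the cross term.
  have h1 := trace_map_sq hφ hone hT a 0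
  have h2 := trace_map_sq hφ hone hT 0 b
  have h3 := trace_mul_comm hφ (T b) (T a)
  simp only [map_add, map_sub, map_smul, smul_eq_mul, pow_two, add_mul, mul_add, mul_zero,
    zero_mul, smul_zero, add_zero, zero_add, h3] at h h1 h2
  linear_combination (h - h1 - h2) / 2

/-- By `trace_map_mul` the cubic identity becomes `φ (T (x ^ 3)) = φ (T x ^ 3)`. Its part quadratic
in `a` and linear in `b` is a sum of three words, equal under the trace by cyclicity. -/
lemma trace_map_sq_mul (hφ : IsFaithfulTracialState (φ : A →ₗ[ℂ] ℂ))
    {T : B →ₗ[ℂ] A} (hone : T 1 = 1) (hT : ∀ b ∈ principalComponent B, IsUnit (T b)) (a b : B) :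
    φ (T (a ^ 2) * T b) = φ (T a ^ 2 * T b) := by
  have hmul := trace_map_mul hφ hone hT
  have hcube : ∀ x : B, φ (T (x * (x * x))) = φ (T x * (T x * T x)) := by
    intro x
    have h := trace_map_cube hφ hone hT x
    simp only [map_add, map_sub, map_nsmul, pow_succ, pow_zero, one_mul, ← hmul,
      mul_assoc] at h
    rw [nsmul_eq_mul, nsmul_eq_mul] at h
    push_cast at h
    linear_combination -h / 2
  have hcyc : ∀ x y : B, φ (T (x * y)) = φ (T (y * x)) := fun x y => by
    rw [hmul, hmul, trace_mul_comm hφ]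
  have h1 := hcube (a + b)
  have h2 := hcube (a - b)
  have h3 := hcube b
  have h4 := hcyc a (b * a)
  have h5 := hcyc b (a * a)
  have h6 := trace_mul_comm hφ (T a) (T b * T a)
  have h7 := trace_mul_comm hφ (T b) (T a * T a)
  simp only [map_add, map_sub, add_mul, mul_add, sub_mul, mul_sub, mul_assoc] at h1 h2 h4 h5 h6 h7
  rw [← hmul, pow_two, pow_two, mul_assoc, mul_assoc]
  linear_combination (h1 - h2 - 2 * h3) / 6 - (h4 + 2 * h5 - h6 - 2 * h7) / 3

end

end TracialState


theorem mainTheorem4 {B A : Type*} [NormedRing B] [NormedAlgebra ℂ B] [CompleteSpace B]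
    [CStarAlgebra A] (hA : ∃ τ : A →ₗ[ℂ] ℂ, IsFaithfulTracialState τ)
    (T : B →ₗ[ℂ] A) (hsurj : Function.Surjective T) (hone : T 1 = 1)
    (hT : ∀ b ∈ principalComponent B, IsUnit (T b)) :
    IsJordanHom T := by
  obtain ⟨τ, hτ⟩ := hA
  obtain ⟨φ, rfl⟩ := TracialState.exists_continuousLinearMap hτ
  intro a
  -- This `b` turns the identity into `φ (star x * x) = 0` for the defect `x = T (a ^ 2) - T a ^ 2`.
  obtain ⟨b, hb⟩ := hsurj (star (T (a ^ 2) - T a ^ 2))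
  have h := TracialState.trace_map_sq_mul hτ hone hT a b
  rw [← sub_eq_zero, ← map_sub, ← sub_mul, hb, TracialState.trace_mul_comm hτ] at h
  exact sub_eq_zero.1 (hτ.faithful _ h)
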